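/- Let $q$ be an indeterminate, $[m]_q=1+q+\cdots+q^{m-1}$ and $[k]_q!=[1]_q[2]_q\cdots[k]_q$, and define the $q$-Stirling numbers of the second kind by $S_q(0,0)=1$, $S_q(n,k)=q^{k-1}S_q(n-1,k-1)+[k]_q\,S_q(n-1,k)$ for $0<k\le n$, and $S_q(n,k)=0$ otherwise. For a word $w=w_1\cdots w_n$ of positive integers let $\mathrm{bk}(w)$ be its largest letter. The word $w$ is an unrestricted growth function if every $j$ with $1\le j\le \mathrm{bk}(w)$ appears in $w$; let $\mathcal{URG}(n,k)$ be the set of all unrestricted growth functions $w$ of length $n$ with $\mathrm{bk}(w)=k$ (these words encode the ordered partitions $B_1/\cdots/B_k$ of $\{1,\dots,n\}$ into $k$ blocks, through $w_i=j$ if and only if $i\in B_j$). For letters $a,b$ of $w$ write $a\succ b$ if the leftmost occurrence of $a$ in $w$ lies to the right of the rightmost occurrence of $b$, and let $\chi(P)$ be $1$ if $P$ is true and $0$ otherwise. Put $$\mathrm{MIL}(w)=\sum_{i=1}^n (w_i-1),\qquad \mathrm{bMAJ}(w)=\sum_{i=1}^{\mathrm{bk}(w)-1} i\,\chi(i\succ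 i+1),\qquad \mathrm{bndes}(w)=\mathrm{bk}(w)-1-\sum_{i=1}^{\mathrm{bk}(w)-1}\chi(i\succ i+1),$$ let $\mathrm{pro}(w)$ be the position of the rightmost letter $1$ in $w$, and let $$\mathrm{bmajMIL}(w)=\mathrm{bMAJ}(w)+\mathrm{MIL}(w),\qquad \mathrm{bmajBAST}(w)=\mathrm{bmajMIL}(w)+\mathrm{pro}(w)+\mathrm{bndes}(w)-n .$$ **Theorem.** For all integers $n\ge k\ge 1$, $$\sum_{w\in\mathcal{URG}(n,k)}q^{\mathrm{bmajMIL}(w)}=\sum_{w\in\mathcal{URG}(n,k)}q^{\mathrm{bmajBAST}(w)}=[k]_q!\cdot S_q(n,k),$$ as an identity of Laurent polynomials in $q$ with integer coefficients. That is, both $\mathrm{bmajMIL}$ and $\mathrm{bmajBAST}$ are Euler–Mahonian statistics, meaning that their distribution on $\mathcal{URG}(n,k)$ is given by $[k]_q!\cdot S_q(n,k)$. -/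

import Mathlib

open Polynomial

namespace GrowthFunction

/-! ### Words

A word `w = w₁ ⋯ wₙ` is a function `w : Fin n → ℕ`; the index `i : Fin n` stands for the
position `i + 1` of the word, and the letters of the words that matter here are positive. -/

variable {n : ℕ}

/-- The largest letter `bk(w)` of `w`. -/
def bk (w : Fin n → ℕ) : ℕ := Finset.univ.sup w

/-- `w` is an unrestricted growth function: its letters are positive, and every `j` with
`1 ≤ j ≤ bk(w)` appears in `w`. -/
def IsURG (w : Fin n → ℕ) : Prop :=
  (∀ i, 1 ≤ w i) ∧ ∀ j ∈ Finset.Icc 1 (bk w), ∃ i, w i = j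

instance (w : Fin n → ℕ) : Decidable (IsURG w) := by
  unfold IsURG; infer_instance

/-- The finite set `URG(n, k)` of all unrestricted growth functions `w` of length `n` with
`bk(w) = k`; see `mem_URG`. -/
def URG (n k : ℕ) : Finset (Fin n → ℕ) :=
  (Fintype.piFinset fun _ : Fin n => Finset.Icc 1 k).filter fun w => IsURG w ∧ bk w = k

theorem mem_URG {k : ℕ} {w : Fin n → ℕ} : w ∈ URG n k ↔ IsURG w ∧ bk w = k := by
  simp only [URG, Finset.mem_filter, Fintype.mem_piFinset, Finset.mem_Icc, and_iff_right_iff_imp]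
  rintro ⟨h, rfl⟩ i
  exact ⟨h.1 i, Finset.le_sup (f := w) (Finset.mem_univ i)⟩

/-- The positions `i` such that `w i` is the leftmost occurrence of its letter. -/
def L (w : Fin n → ℕ) : Finset (Fin n) :=
  Finset.univ.filter fun i => ∀ j, j < i → w j ≠ w i

/-- The positions `i` such that `w i` is the rightmost occurrence of its letter. -/
def R (w : Fin n → ℕ) : Finset (Fin n) :=
  Finset.univ.filter fun i => ∀ j, i < j → w j ≠ w i

/-- The relation `a ≻ b` on the letters of `w`: the leftmost `a` of `w` lies to the right of the
rightmost `b` of `w`. -/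
def Succ (w : Fin n → ℕ) (a b : ℕ) : Prop :=
  ∃ i ∈ L w, ∃ j ∈ R w, w i = a ∧ w j = b ∧ j < i

instance (w : Fin n → ℕ) (a b : ℕ) : Decidable (Succ w a b) := by
  unfold Succ; infer_instance

/-! ### Statistics -/

/-- The position (counted from `1`) of the rightmost letter `1` of `w`. -/
def pro (w : Fin n → ℕ) : ℕ :=
  (Finset.univ.filter fun i => w i = 1).sup fun i => (i : ℕ) + 1

/-- `MIL(w) = ∑ᵢ (wᵢ - 1)`. -/
def MIL (w : Fin n → ℕ) : ℤ := ∑ i, ((w i : ℤ) - 1)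

/-- `bMAJ(w) = ∑ᵢ i χ(i ≻ i + 1)`, the sum being over the letters `1 ≤ i < bk(w)`. -/
def bMAJ (w : Fin n → ℕ) : ℤ :=
  ∑ i ∈ Finset.Ico 1 (bk w), (i : ℤ) * (if Succ w i (i + 1) then 1 else 0)

/-- `bmajMIL(w) = bMAJ(w) + MIL(w)`. -/
def bmajMIL (w : Fin n → ℕ) : ℤ := bMAJ w + MIL w

/-- The number of block nondescents, `bndes(w) = bk(w) - 1 - ∑ᵢ χ(i ≻ i + 1)`. -/
def bndes (w : Fin n → ℕ) : ℤ :=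
  (bk w : ℤ) - 1 - ∑ i ∈ Finset.Ico 1 (bk w), (if Succ w i (i + 1) then 1 else 0)

/-- `bmajBAST(w) = bmajMIL(w) + pro(w) + bndes(w) - n`. -/
def bmajBAST (w : Fin n → ℕ) : ℤ := bmajMIL w + (pro w : ℤ) + bndes w - (n : ℤ)

/-! ### `q`-numbers, as polynomials in the indeterminate `q = X` -/

/-- `[k]_q = 1 + q + ⋯ + q^(k-1)`. -/
noncomputable def qInt (k : ℕ) : ℤ[X] := ∑ i ∈ Finset.range k, X ^ i

/-- `[k]_q! = [1]_q [2]_q ⋯ [k]_q`. -/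
noncomputable def qFact (k : ℕ) : ℤ[X] := ∏ i ∈ Finset.Icc 1 k, qInt i

/-- The `q`-Stirling numbers of the second kind: `S_q(0, 0) = 1`,
`S_q(n, k) = q^(k-1) S_q(n-1, k-1) + [k]_q S_q(n-1, k)` for `0 < k ≤ n`, and `S_q(n, k) = 0`
otherwise. -/
noncomputable def qStirling : ℕ → ℕ → ℤ[X]
  | 0, 0 => 1
  | 0, _ + 1 => 0
  | _ + 1, 0 => 0
  | n + 1, k + 1 =>
    if k + 1 ≤ n + 1 then X ^ k * qStirling n k + qInt (k + 1) * qStirling n (k + 1) else 0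

end GrowthFunction

/-!
Write `F(n, k)` for `[k]_q! S_q(n, k)`, which satisfies
`F(n + 1, k) = [k]_q (q ^ (k - 1) F(n, k - 1) + F(n, k))`. Both sums over `URG(n, k)` are shown to be
equal to `F(n, k)`.

For `bmajMIL`, every factor `q ^ (i χ(i ≻ i + 1))` is expanded as `1 + (q ^ i - 1) χ(i ≻ i + 1)`.
Collecting the terms by the run `a + 1 ≻ a + 2 ≻ ⋯ ≻ k` of imposed relations that ends at the letter
`k`, a word is an arbitrary word with letters `1, …, a` shuffled with a weakly decreasing word with
letters `a + 1, …, k` (`sum_wordsOn_eq_sum_powerset`, `sum_isRun_eq`). So the generating function `G_k`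
is the sum over `a < k` of `∏ (q ^ i - 1)`, `a < i < k`, times the binomial convolution of `G_a` with
the generating function `runSum a k` of the weakly decreasing words. The numbers `F(n, k)` satisfy
the same identity (`sum_runCoeff_mul_binomConv`), by induction on `n`: the shift of `n` is a
derivation for the binomial convolution, and removing the last letter or the first letter of a
weakly decreasing word gives two expressions for `runSum` whose comparison makes the unwanted terms
telescope. Induction on `k` then gives `G_k = F(·, k)` (`sum_wordsOn`).

For `bmajBAST`, the pair `(1, 2)` contributes `1 - 1 = 0` to `bMAJ - ∑ χ` when `1 ≻ 2`, so that the
position set `I ≠ ∅` of the letter `1` is independent of the remaining word; with its letters lowered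
by one, that word is counted by `bmajMIL` (`bmajBAST_add`). Hence the sum is
`q ^ (k - 1) ∑_I q ^ (max I - |I|) F(n - |I|, k - 1)`, positions being counted from `1`, and this
satisfies the recursion of `F(n, k)` (`lastTransform_eulerMahonian`), through the identity
`∑ⱼ (n choose j) q ^ (n - j) F(n - j, k) = q ^ k F(n, k) + F(n, k + 1)`
(`binomTransform_eulerMahonian`).
-/

namespace GrowthFunction

/-! ### The `q`-Stirling side -/

theorem qInt_succ (k : ℕ) : qInt (k + 1) = qInt k + X ^ k := by
  simp [qInt, Finset.sum_range_succ]

theorem sub_one_mul_qInt (k : ℕ) : (X - 1) * qInt k = X ^ k - 1 := by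
  rw [qInt, mul_comm, geom_sum_mul]

theorem qInt_succ' (k : ℕ) : qInt (k + 1) = 1 + X * qInt k := by
  rw [qInt_succ]
  linear_combination -sub_one_mul_qInt k

theorem qStirling_eq_zero {n k : ℕ} (h : n < k) : qStirling n k = 0 := by
  obtain _ | k := k
  · omega
  obtain _ | n := n
  · rfl
  · rw [qStirling, if_neg (by omega)]

/-- The expected distribution `[k]_q! S_q(n, k)`. -/
noncomputable def eulerMahonian (n k : ℕ) : ℤ[X] := qFact k * qStirling n k

@[simp] theorem eulerMahonian_zero_zero : eulerMahonian 0 0 = 1 := by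
  simp [eulerMahonian, qFact, qStirling]

@[simp] theorem eulerMahonian_succ_zero (n : ℕ) : eulerMahonian (n + 1) 0 = 0 := by
  simp [eulerMahonian, qStirling]

@[simp] theorem eulerMahonian_zero_succ (k : ℕ) : eulerMahonian 0 (k + 1) = 0 := by
  simp [eulerMahonian, qStirling]

theorem eulerMahonian_succ_succ (n k : ℕ) : eulerMahonian (n + 1) (k + 1) =
    qInt (k + 1) * (X ^ k * eulerMahonian n k + eulerMahonian n (k + 1)) := by
  have hS : qStirling (n + 1) (k + 1) =
      X ^ k * qStirling n k + qInt (k + 1) * qStirling n (k + 1) := by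
    rw [qStirling]
    split_ifs with h
    · rfl
    · rw [qStirling_eq_zero (show n < k by omega), qStirling_eq_zero (show n < k + 1 by omega)]
      ring
  have hF : qFact (k + 1) = qFact k * qInt (k + 1) := by
    rw [qFact, Finset.prod_Icc_succ_top (by omega), qFact]
  rw [eulerMahonian, eulerMahonian, eulerMahonian, hS, hF]
  ring

/-! ### Binomial convolution -/

/-- The binomial convolution `n ↦ ∑ⱼ (n choose j) f(j) g(n - j)`, written as a sum over subsets: it
is the product of exponential generating functions, and the shift `f ↦ f (· + 1)` is a derivation
for it. -/
noncomputable def binomConv (f g : ℕ → ℤ[X]) (n : ℕ) : ℤ[X] :=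
  ∑ I ∈ (Finset.range n).powerset, f I.card * g (n - I.card)

theorem binomConv_zero (f g : ℕ → ℤ[X]) : binomConv f g 0 = f 0 * g 0 := by
  simp [binomConv]

theorem card_le_of_mem_powerset_range {n : ℕ} {I : Finset ℕ}
    (h : I ∈ (Finset.range n).powerset) : I.card ≤ n := by
  simpa using Finset.card_le_card (Finset.mem_powerset.1 h)

theorem notMem_of_mem_powerset_range {n : ℕ} {I : Finset ℕ}
    (h : I ∈ (Finset.range n).powerset) : n ∉ I := fun hn => by
  simpa using Finset.mem_powerset.1 h hn

theorem binomConv_succ (f g : ℕ → ℤ[X]) (n : ℕ) :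
    binomConv f g (n + 1) =
      binomConv (fun m => f (m + 1)) g n + binomConv f (fun m => g (m + 1)) n := by
  rw [binomConv, Finset.range_add_one, Finset.sum_powerset_insert (by simp), add_comm]
  congr 1
  · refine Finset.sum_congr rfl fun I hI => ?_
    rw [Finset.card_insert_of_notMem (notMem_of_mem_powerset_range hI), Nat.add_sub_add_right]
  · refine Finset.sum_congr rfl fun I hI => ?_
    rw [Nat.sub_add_comm (card_le_of_mem_powerset_range hI)]

theorem sum_powerset_eq_binomConv {α : Type*} [DecidableEq α] (f g : ℕ → ℤ[X]) (J : Finset α) :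
    ∑ I ∈ J.powerset, f I.card * g (J \ I).card = binomConv f g J.card := by
  have h : ∀ I ∈ J.powerset, f I.card * g (J \ I).card = f I.card * g (J.card - I.card) := by
    intro I hI
    rw [Finset.card_sdiff_of_subset (Finset.mem_powerset.1 hI)]
  rw [Finset.sum_congr rfl h, binomConv,
    Finset.sum_powerset_apply_card (fun m => f m * g (J.card - m)),
    Finset.sum_powerset_apply_card (fun m => f m * g (J.card - m)), Finset.card_range]

/-! ### Weakly decreasing words -/

/-- The sum of `q ^ ∑ᵢ (wᵢ - 1)` over the weakly decreasing words `w` of length `n` whose set of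
letters is `{a + 1, …, b}`, through the recursion that removes the last letter, which is `a + 1`;
see `sum_runWords`. -/
noncomputable def runSum : ℕ → ℕ → ℕ → ℤ[X]
  | a, b, 0 => if b ≤ a then 1 else 0
  | a, b, n + 1 => if b ≤ a then 0 else X ^ a * (runSum a b n + runSum (a + 1) b n)

theorem runSum_succ {a b : ℕ} (h : a < b) (n : ℕ) :
    runSum a b (n + 1) = X ^ a * (runSum a b n + runSum (a + 1) b n) := by
  rw [runSum, if_neg (by omega)]

/-- The recursion that removes the first letter instead of the last one. -/
theorem runSum_succ' {a b : ℕ} (h : a ≤ b) (n : ℕ) :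
    runSum a (b + 1) (n + 1) = X ^ b * (runSum a (b + 1) n + runSum a b n) := by
  induction n generalizing a with
  | zero =>
    rw [runSum_succ (by omega)]
    rcases h.eq_or_lt with rfl | h
    · simp [runSum]
    · simp [runSum, show ¬ b + 1 ≤ a by omega, show ¬ b ≤ a by omega]
  | succ n ih =>
    rcases h.eq_or_lt with rfl | h
    · rw [runSum_succ (by omega)]
      simp [runSum]
    · have h1 := ih h.le
      rw [runSum_succ (by omega)] at h1
      rw [runSum_succ (by omega), ih h.le, ih h, runSum_succ h]
      linear_combination X ^ b * h1

theorem runSum_exchange {a b : ℕ} (h : a ≤ b) (n : ℕ) :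
    X ^ a * (runSum a (b + 1) n + runSum (a + 1) (b + 1) n) =
      X ^ b * (runSum a (b + 1) n + runSum a b n) := by
  rw [← runSum_succ (by omega), runSum_succ' h]

theorem binomConv_runSum_self (f : ℕ → ℤ[X]) (a n : ℕ) :
    binomConv f (runSum a a) n = f n := by
  have h : ∀ m, m ≠ 0 → runSum a a m = 0 := fun m hm => by
    obtain ⟨m, rfl⟩ := Nat.exists_eq_succ_of_ne_zero hm
    simp [runSum]
  rw [binomConv, Finset.sum_eq_single (Finset.range n)]
  · simp [runSum]
  · intro I hI hne
    rw [h, mul_zero]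
    have := Finset.card_lt_card (Finset.ssubset_iff_subset_ne.2 ⟨Finset.mem_powerset.1 hI, hne⟩)
    rw [Finset.card_range] at this
    omega
  · simp

/-! ### The convolution identity -/

/-- The coefficient of the words in which `a + 1 ≻ a + 2 ≻ ⋯ ≻ k` is imposed, when every factor
`q ^ (i χ(i ≻ i + 1))` is expanded as `1 + (q ^ i - 1) χ(i ≻ i + 1)`. -/
noncomputable def runCoeff (a k : ℕ) : ℤ[X] := ∏ i ∈ Finset.Ico (a + 1) k, (X ^ i - 1)

theorem runCoeff_self_succ (k : ℕ) : runCoeff k (k + 1) = 1 := by simp [runCoeff]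

theorem runCoeff_succ_right {a k : ℕ} (h : a < k) :
    runCoeff a (k + 1) = runCoeff a k * (X ^ k - 1) := by
  rw [runCoeff, Finset.prod_Ico_succ_top (by omega), runCoeff]

theorem runCoeff_eq_mul {a k : ℕ} (h : a + 1 < k) :
    runCoeff a k = (X ^ (a + 1) - 1) * runCoeff (a + 1) k := by
  rw [runCoeff, Finset.prod_eq_prod_Ico_succ_bot h, runCoeff]

theorem qInt_mul_runCoeff {a k : ℕ} (h : a < k) :
    qInt k * runCoeff a k = qInt (a + 1) * runCoeff (a + 1) (k + 1) := by
  refine mul_left_cancel₀ (X_sub_C_ne_zero (1 : ℤ)) ?_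
  rw [map_one]
  have h1 := runCoeff_eq_mul (show a + 1 < k + 1 by omega)
  rw [runCoeff_succ_right h] at h1
  linear_combination h1 + runCoeff a k * sub_one_mul_qInt k -
    runCoeff (a + 1) (k + 1) * sub_one_mul_qInt (a + 1)

theorem binomConv_congr {f f' g g' : ℕ → ℤ[X]} (n : ℕ) (hf : ∀ m, f m = f' m)
    (hg : ∀ m, g m = g' m) : binomConv f g n = binomConv f' g' n := by
  rw [funext hf, funext hg]

theorem binomConv_add_right (f g g' : ℕ → ℤ[X]) (n : ℕ) :
    binomConv f (fun m => g m + g' m) n = binomConv f g n + binomConv f g' n := by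
  simp only [binomConv, mul_add, Finset.sum_add_distrib]

theorem binomConv_mul_right (c : ℤ[X]) (f g : ℕ → ℤ[X]) (n : ℕ) :
    binomConv f (fun m => c * g m) n = c * binomConv f g n := by
  simp only [binomConv, Finset.mul_sum]
  exact Finset.sum_congr rfl fun _ _ => by ring

theorem binomConv_add_left (f f' g : ℕ → ℤ[X]) (n : ℕ) :
    binomConv (fun m => f m + f' m) g n = binomConv f g n + binomConv f' g n := by
  simp only [binomConv, add_mul, Finset.sum_add_distrib]

theorem binomConv_mul_left (c : ℤ[X]) (f g : ℕ → ℤ[X]) (n : ℕ) :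
    binomConv (fun m => c * f m) g n = c * binomConv f g n := by
  simp only [binomConv, Finset.mul_sum]
  exact Finset.sum_congr rfl fun _ _ => by ring

/-- The summand of index `a` in the recursion of `sum_runCoeff_mul_binomConv`. -/
theorem runCoeff_telescope {a k : ℕ} (h : a < k) {p₀ p₁ s : ℤ[X]}
    (hp : X ^ a * (p₀ + p₁) = X ^ k * (p₀ + s)) :
    runCoeff (a + 1) (k + 1) * (qInt (a + 1) * (X ^ a * p₁)) +
      runCoeff a (k + 1) * (qInt a * p₀ + X ^ a * (p₀ + p₁)) =
    qInt (k + 1) * (runCoeff a (k + 1) * p₀) + X ^ (k + 1) * (qInt k * (runCoeff a k * s)) := by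
  have hc := runCoeff_eq_mul (show a + 1 < k + 1 by omega)
  have hs := qInt_mul_runCoeff h
  have ha := sub_one_mul_qInt (a + 1)
  have hk := sub_one_mul_qInt (k + 1)
  have hq := qInt_succ a
  rw [← ha] at hc
  rw [hc]
  set c := runCoeff (a + 1) (k + 1)
  linear_combination (-X ^ (k + 1) * s) * hs - qInt (a + 1) * c * (X - 1) * p₀ * hq -
    qInt (a + 1) * c * p₀ * hk + qInt (a + 1) * c * p₀ * ha + X * qInt (a + 1) * c * hp

theorem sum_runCoeff_telescope {k : ℕ} {p₀ p₁ s : ℕ → ℤ[X]}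
    (hp : ∀ a ∈ Finset.range k, X ^ a * (p₀ a + p₁ a) = X ^ k * (p₀ a + s a)) :
    ∑ a ∈ Finset.range k, runCoeff (a + 1) (k + 1) * (qInt (a + 1) * (X ^ a * p₁ a)) +
      ∑ a ∈ Finset.range (k + 1),
        runCoeff a (k + 1) * (qInt a * p₀ a + X ^ a * (p₀ a + p₁ a)) =
    qInt (k + 1) * ∑ a ∈ Finset.range (k + 1), runCoeff a (k + 1) * p₀ a +
      X ^ (k + 1) * (qInt k * ∑ a ∈ Finset.range k, runCoeff a k * s a) + X ^ k * p₁ k := by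
  rw [Finset.sum_range_succ, ← add_assoc, ← Finset.sum_add_distrib,
    Finset.sum_congr rfl fun a ha => runCoeff_telescope (Finset.mem_range.1 ha) (hp a ha),
    Finset.sum_add_distrib, ← Finset.mul_sum, ← Finset.mul_sum, ← Finset.mul_sum,
    Finset.sum_range_succ _ k, runCoeff_self_succ]
  linear_combination -p₀ k * qInt_succ k

theorem binomConv_eulerMahonian_succ_left (g : ℕ → ℤ[X]) (n a : ℕ) :
    binomConv (fun m => eulerMahonian (m + 1) (a + 1)) g n =
      qInt (a + 1) * (X ^ a * binomConv (fun m => eulerMahonian m a) g n) +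
        qInt (a + 1) * binomConv (fun m => eulerMahonian m (a + 1)) g n := by
  rw [← mul_add, ← binomConv_mul_left, ← binomConv_add_left, ← binomConv_mul_left]
  exact binomConv_congr n (fun m => eulerMahonian_succ_succ m a) fun _ => rfl

/-- Leibniz' rule for the convolutions below, with the terms regrouped by the first factor. -/
theorem sum_binomConv_succ (n k : ℕ) (p₀ p₁ : ℕ → ℤ[X])
    (h₀ : ∀ a, binomConv (fun m => eulerMahonian m a) (runSum a (k + 1)) n = p₀ a)
    (h₁ : ∀ a, binomConv (fun m => eulerMahonian m a) (runSum (a + 1) (k + 1)) n = p₁ a) :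
    ∑ a ∈ Finset.range (k + 1), runCoeff a (k + 1) *
      binomConv (fun m => eulerMahonian m a) (runSum a (k + 1)) (n + 1) =
    ∑ a ∈ Finset.range k, runCoeff (a + 1) (k + 1) * (qInt (a + 1) * (X ^ a * p₁ a)) +
      ∑ a ∈ Finset.range (k + 1),
        runCoeff a (k + 1) * (qInt a * p₀ a + X ^ a * (p₀ a + p₁ a)) := by
  have hright : ∀ a ∈ Finset.range (k + 1),
      binomConv (fun m => eulerMahonian m a) (fun m => runSum a (k + 1) (m + 1)) n =
        X ^ a * (p₀ a + p₁ a) := by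
    intro a ha
    rw [← h₀, ← h₁, ← binomConv_add_right, ← binomConv_mul_right]
    exact binomConv_congr n (fun _ => rfl) fun m => runSum_succ (by simpa using ha) m
  have hleft0 : binomConv (fun m => eulerMahonian (m + 1) 0) (runSum 0 (k + 1)) n = 0 := by
    simp [binomConv]
  have hsplit : ∀ a ∈ Finset.range (k + 1), runCoeff a (k + 1) *
      binomConv (fun m => eulerMahonian m a) (runSum a (k + 1)) (n + 1) =
      runCoeff a (k + 1) * binomConv (fun m => eulerMahonian (m + 1) a) (runSum a (k + 1)) n +
        runCoeff a (k + 1) * (X ^ a * (p₀ a + p₁ a)) := by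
    intro a ha
    rw [binomConv_succ, hright a ha, mul_add]
  have hzero : runCoeff 0 (k + 1) * (qInt 0 * p₀ 0) = 0 := by simp [qInt]
  rw [Finset.sum_congr rfl hsplit, Finset.sum_add_distrib, Finset.sum_range_succ', hleft0,
    mul_zero, add_zero]
  simp only [binomConv_eulerMahonian_succ_left, h₀, h₁, mul_add _ (qInt _ * _),
    Finset.sum_add_distrib]
  rw [Finset.sum_range_succ' (fun a => runCoeff a (k + 1) * (qInt a * p₀ a)), hzero, add_zero,
    add_assoc]

/-- Both sides satisfy the recursion of the `q`-Stirling numbers in `n`: by the Leibniz rule the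
left-hand side does so up to terms that `runSum_exchange` makes telescope. -/
theorem sum_runCoeff_mul_binomConv (n k : ℕ) :
    ∑ a ∈ Finset.range (k + 1), runCoeff a (k + 1) *
      binomConv (fun m => eulerMahonian m a) (runSum a (k + 1)) n = eulerMahonian n (k + 1) := by
  induction n generalizing k with
  | zero =>
    rw [eulerMahonian_zero_succ]
    refine Finset.sum_eq_zero fun a ha => ?_
    have : ¬ k + 1 ≤ a := by simpa using ha
    simp [binomConv_zero, runSum, this]
  | succ n ih =>
    have hIH : qInt k * ∑ a ∈ Finset.range k, runCoeff a k *
        binomConv (fun m => eulerMahonian m a) (runSum a k) n = qInt k * eulerMahonian n k := by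
      obtain _ | k := k
      · simp [qInt]
      · rw [ih]
    rw [sum_binomConv_succ n k _ _ (fun _ => rfl) (fun _ => rfl),
      sum_runCoeff_telescope (s := fun a => binomConv (fun m => eulerMahonian m a) (runSum a k) n),
      ih, hIH, binomConv_runSum_self, eulerMahonian_succ_succ]
    · linear_combination -X ^ k * eulerMahonian n k * qInt_succ' k
    · intro a ha
      rw [← binomConv_add_right, ← binomConv_add_right, ← binomConv_mul_right,
        ← binomConv_mul_right]
      exact binomConv_congr n (fun _ => rfl) fun m =>
        runSum_exchange (Finset.mem_range.1 ha).le m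

/-! ### Summing over the position of the last letter `1` -/

/-- `∑ⱼ (n choose j) q ^ (n - j) f(n - j)`. -/
noncomputable def binomTransform (f : ℕ → ℤ[X]) (n : ℕ) : ℤ[X] :=
  ∑ I ∈ (Finset.range n).powerset, X ^ (n - I.card) * f (n - I.card)

theorem binomTransform_succ (f : ℕ → ℤ[X]) (n : ℕ) :
    binomTransform f (n + 1) =
      X * binomTransform (fun m => f (m + 1)) n + binomTransform f n := by
  rw [binomTransform, Finset.range_add_one, Finset.sum_powerset_insert (by simp), binomTransform,
    binomTransform, Finset.mul_sum]
  congr 1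
  · refine Finset.sum_congr rfl fun I hI => ?_
    rw [Nat.sub_add_comm (card_le_of_mem_powerset_range hI)]
    ring
  · refine Finset.sum_congr rfl fun I hI => ?_
    rw [Finset.card_insert_of_notMem (notMem_of_mem_powerset_range hI), Nat.add_sub_add_right]

theorem binomTransform_eulerMahonian_succ (n k : ℕ) :
    binomTransform (fun m => eulerMahonian (m + 1) (k + 1)) n =
      qInt (k + 1) * (X ^ k * binomTransform (fun m => eulerMahonian m k) n +
        binomTransform (fun m => eulerMahonian m (k + 1)) n) := by
  simp only [binomTransform, Finset.mul_sum, ← Finset.sum_add_distrib]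
  refine Finset.sum_congr rfl fun I _ => ?_
  rw [eulerMahonian_succ_succ]
  ring

theorem binomTransform_eulerMahonian (n k : ℕ) :
    binomTransform (fun m => eulerMahonian m k) n =
      X ^ k * eulerMahonian n k + eulerMahonian n (k + 1) := by
  induction n generalizing k with
  | zero => obtain _ | k := k <;> simp [binomTransform]
  | succ n ih =>
    rw [binomTransform_succ, ih, eulerMahonian_succ_succ n k]
    obtain _ | k := k
    · simp [binomTransform, qInt]
    · rw [binomTransform_eulerMahonian_succ, ih, ih, eulerMahonian_succ_succ n k]
      linear_combination (-X ^ (k + 1) * eulerMahonian n (k + 1) - eulerMahonian n (k + 1 + 1)) *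
        qInt_succ' (k + 1)

/-- The sum over the nonempty `I ⊆ {0, …, n - 1}` of `q ^ e f(n - |I|)`, where `e` is the number of
`i < max I` outside `I`. -/
noncomputable def lastTransform (f : ℕ → ℤ[X]) (n : ℕ) : ℤ[X] :=
  ∑ I ∈ (Finset.range n).powerset,
    if I.Nonempty then X ^ (I.sup (· + 1) - I.card) * f (n - I.card) else 0

/-- The two terms come from the sets without and with the last position `n`. -/
theorem lastTransform_succ (f : ℕ → ℤ[X]) (n : ℕ) :
    lastTransform f (n + 1) = lastTransform (fun m => f (m + 1)) n + binomTransform f n := by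
  rw [lastTransform, Finset.range_add_one, Finset.sum_powerset_insert (by simp), lastTransform,
    binomTransform]
  congr 1
  · refine Finset.sum_congr rfl fun I hI => ?_
    rw [Nat.sub_add_comm (card_le_of_mem_powerset_range hI)]
  · refine Finset.sum_congr rfl fun I hI => ?_
    have hsup : (insert n I).sup (· + 1) = n + 1 := by
      rw [Finset.sup_insert, sup_eq_left]
      refine Finset.sup_le fun i hi => ?_
      have := Finset.mem_powerset.1 hI hi
      simp only [Finset.mem_range] at this
      omega
    rw [if_pos (Finset.insert_nonempty n I), hsup,
      Finset.card_insert_of_notMem (notMem_of_mem_powerset_range hI), Nat.add_sub_add_right]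

theorem lastTransform_eulerMahonian_succ (n k : ℕ) :
    lastTransform (fun m => eulerMahonian (m + 1) (k + 1)) n =
      qInt (k + 1) * (X ^ k * lastTransform (fun m => eulerMahonian m k) n +
        lastTransform (fun m => eulerMahonian m (k + 1)) n) := by
  simp only [lastTransform, Finset.mul_sum, ← Finset.sum_add_distrib]
  refine Finset.sum_congr rfl fun I _ => ?_
  rw [eulerMahonian_succ_succ]
  split_ifs <;> ring

theorem lastTransform_eulerMahonian (n k : ℕ) :
    X ^ k * lastTransform (fun m => eulerMahonian m k) n = eulerMahonian n (k + 1) := by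
  induction n generalizing k with
  | zero => simp [lastTransform]
  | succ n ih =>
    rw [lastTransform_succ, mul_add, binomTransform_eulerMahonian, eulerMahonian_succ_succ n k,
      qInt_succ]
    obtain _ | k := k
    · simp [lastTransform, qInt]
    · rw [lastTransform_eulerMahonian_succ, ih]
      linear_combination qInt (k + 1) * ih (k + 1)

/-! ### Words on a set of positions -/

/-- The words on the set `J` of positions whose set of letters is `{a, …, b}`, encoded as functions
on all positions with the value `0`, which stands for a blank, outside `J`. The encoding is faithful
for `1 ≤ a`. -/
def wordsOn {n : ℕ} (J : Finset (Fin n)) (a b : ℕ) : Finset (Fin n → ℕ) :=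
  (Fintype.piFinset fun i => if i ∈ J then Finset.Icc a b else {0}).filter
    fun w => ∀ l ∈ Finset.Icc a b, ∃ i, w i = l

theorem mem_wordsOn {n : ℕ} {J : Finset (Fin n)} {a b : ℕ} {w : Fin n → ℕ} :
    w ∈ wordsOn J a b ↔ (∀ i ∈ J, a ≤ w i ∧ w i ≤ b) ∧ (∀ i ∉ J, w i = 0) ∧
      ∀ l, a ≤ l → l ≤ b → ∃ i, w i = l := by
  simp only [wordsOn, Finset.mem_filter, Fintype.mem_piFinset, Finset.mem_Icc, and_imp]
  constructor
  · rintro ⟨h, h'⟩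
    refine ⟨fun i hi => ?_, fun i hi => ?_, h'⟩
    · simpa [hi] using h i
    · simpa [hi] using h i
  · rintro ⟨h₁, h₂, h₃⟩
    refine ⟨fun i => ?_, h₃⟩
    by_cases hi : i ∈ J
    · simpa [hi] using h₁ i hi
    · simpa [hi] using h₂ i hi

theorem wordsOn_univ {n k : ℕ} (hk : 1 ≤ k) : wordsOn Finset.univ 1 k = URG n k := by
  ext w
  simp only [mem_wordsOn, mem_URG, IsURG, Finset.mem_univ, forall_const, not_true_eq_false,
    IsEmpty.forall_iff, implies_true, true_and, Finset.mem_Icc, and_imp]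
  constructor
  · rintro ⟨h₁, h₂⟩
    have hbk : bk w = k := by
      refine le_antisymm (Finset.sup_le fun i _ => (h₁ i).2) ?_
      obtain ⟨i, hi⟩ := h₂ k hk le_rfl
      exact hi ▸ Finset.le_sup (f := w) (Finset.mem_univ i)
    exact ⟨⟨fun i => (h₁ i).1, fun j hj hj' => h₂ j hj (hbk ▸ hj')⟩, hbk⟩
  · rintro ⟨⟨h₁, h₂⟩, rfl⟩
    exact ⟨fun i => ⟨h₁ i, Finset.le_sup (f := w) (Finset.mem_univ i)⟩, h₂⟩

theorem succ_iff {n : ℕ} {w : Fin n → ℕ} {a b : ℕ} :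
    Succ w a b ↔ (∃ i, w i = a) ∧ (∃ j, w j = b) ∧ ∀ i j, w i = a → w j = b → j < i := by
  constructor
  · rintro ⟨i, hi, j, hj, rfl, rfl, hji⟩
    simp only [L, R, Finset.mem_filter, Finset.mem_univ, true_and] at hi hj
    refine ⟨⟨i, rfl⟩, ⟨j, rfl⟩, fun i' j' hi' hj' => ?_⟩
    have h₁ : i ≤ i' := not_lt.1 fun h => hi i' h hi'
    have h₂ : j' ≤ j := not_lt.1 fun h => hj j' h hj'
    exact h₂.trans_lt (hji.trans_le h₁)
  · rintro ⟨⟨i, hi⟩, ⟨j, hj⟩, h⟩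
    have hA : (Finset.univ.filter fun i => w i = a).Nonempty := ⟨i, by simpa using hi⟩
    have hB : (Finset.univ.filter fun i => w i = b).Nonempty := ⟨j, by simpa using hj⟩
    have hi' := Finset.min'_mem _ hA
    have hj' := Finset.max'_mem _ hB
    simp only [Finset.mem_filter, Finset.mem_univ, true_and] at hi' hj'
    refine ⟨_, ?_, _, ?_, hi', hj', h _ _ hi' hj'⟩
    · simp only [L, Finset.mem_filter, Finset.mem_univ, true_and]
      intro m hm hm'
      exact hm.not_ge (Finset.min'_le _ _ (by simpa using hm'.trans hi'))
    · simp only [R, Finset.mem_filter, Finset.mem_univ, true_and]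
      intro m hm hm'
      exact hm.not_ge (Finset.le_max' _ _ (by simpa using hm'.trans hj'))

theorem succ_congr {n : ℕ} {w w' : Fin n → ℕ} {a b a' b' : ℕ} (ha : ∀ i, w i = a ↔ w' i = a')
    (hb : ∀ i, w i = b ↔ w' i = b') : Succ w a b ↔ Succ w' a' b' := by
  simp only [succ_iff, ha, hb]

/-- A word on `J` with letters `1, …, k` is the sum of its part with letters at most `a` and its
part with letters greater than `a`. -/
theorem sum_wordsOn_eq_sum_powerset {n : ℕ} {M : Type*} [AddCommMonoid M] (J : Finset (Fin n))
    {a k : ℕ} (h : a ≤ k) (φ : (Fin n → ℕ) → M) :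
    ∑ w ∈ wordsOn J 1 k, φ w = ∑ I ∈ J.powerset, ∑ u ∈ wordsOn I 1 a,
      ∑ v ∈ wordsOn (J \ I) (a + 1) k, φ (u + v) := by
  rw [← Finset.sum_fiberwise_of_maps_to (t := J.powerset)
    (g := fun w => J.filter fun i => w i ≤ a) fun w _ => by simp]
  refine Finset.sum_congr rfl fun I hI => ?_
  rw [← Finset.sum_product']
  have hIJ := Finset.mem_powerset.1 hI
  refine Finset.sum_bij' (fun w _ => (fun i => if w i ≤ a then w i else 0,
    fun i => if w i ≤ a then 0 else w i)) (fun p _ => p.1 + p.2) ?_ ?_ ?_ ?_ ?_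
  · intro w hw
    simp only [Finset.mem_filter, mem_wordsOn, Finset.mem_product, Finset.mem_sdiff] at hw ⊢
    obtain ⟨⟨h₁, h₂, h₃⟩, rfl⟩ := hw
    simp only [Finset.mem_filter]
    refine ⟨⟨?_, ?_, ?_⟩, ?_, ?_, ?_⟩
    · rintro i ⟨hi, hi'⟩
      simpa [hi'] using (h₁ i hi).1
    · intro i hi
      grind
    · intro l hl hl'
      obtain ⟨i, rfl⟩ := h₃ l hl (hl'.trans h)
      exact ⟨i, if_pos hl'⟩
    · grind
    · grind
    · intro l hl hl'
      obtain ⟨i, rfl⟩ := h₃ l (by omega) hl'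
      exact ⟨i, if_neg (by omega)⟩
  · rintro ⟨u, v⟩ huv
    simp only [Finset.mem_filter, mem_wordsOn, Finset.mem_product, Finset.mem_sdiff,
      Pi.add_apply] at huv ⊢
    obtain ⟨⟨hu₁, hu₂, hu₃⟩, hv₁, hv₂, hv₃⟩ := huv
    refine ⟨⟨?_, ?_, ?_⟩, ?_⟩
    · intro i hi
      by_cases hi' : i ∈ I <;> grind
    · intro i hi
      grind
    · intro l hl hl'
      by_cases hla : l ≤ a
      · obtain ⟨i, rfl⟩ := hu₃ l hl hla
        exact ⟨i, by grind⟩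
      · obtain ⟨i, rfl⟩ := hv₃ l (by omega) hl'
        exact ⟨i, by grind⟩
    · ext i
      simp only [Finset.mem_filter]
      by_cases hi' : i ∈ I <;> grind
  · intro w hw
    ext i
    simp only [Pi.add_apply]
    split_ifs <;> simp
  · rintro ⟨u, v⟩ huv
    simp only [mem_wordsOn, Finset.mem_product, Finset.mem_sdiff] at huv
    obtain ⟨⟨hu₁, hu₂, hu₃⟩, hv₁, hv₂, hv₃⟩ := huv
    refine Prod.ext (funext fun i => ?_) (funext fun i => ?_) <;>
    · simp only [Pi.add_apply]
      by_cases hi' : i ∈ I <;> by_cases hi'' : i ∈ J <;> grind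
  · intro w hw
    congr 1
    ext i
    simp only [Pi.add_apply]
    split_ifs <;> simp

section Decomposition

variable {n : ℕ} {I J : Finset (Fin n)} {u v : Fin n → ℕ} {a k : ℕ}

theorem eq_zero_or_eq_zero (hu : u ∈ wordsOn I 1 a) (hv : v ∈ wordsOn (J \ I) (a + 1) k)
    (i : Fin n) : u i = 0 ∨ v i = 0 := by
  rw [mem_wordsOn] at hu hv
  by_cases hi : i ∈ I
  · exact .inr (hv.2.1 i (by simp [hi]))
  · exact .inl (hu.2.1 i hi)

theorem add_apply_eq_iff_left (hu : u ∈ wordsOn I 1 a) (hv : v ∈ wordsOn (J \ I) (a + 1) k)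
    {l : ℕ} (hl : 1 ≤ l) (hl' : l ≤ a) (i : Fin n) : (u + v) i = l ↔ u i = l := by
  have h := eq_zero_or_eq_zero hu hv i
  rw [mem_wordsOn] at hv
  have h₁ := hv.1 i
  have h₂ := hv.2.1 i
  rw [Pi.add_apply]
  by_cases hi : i ∈ J \ I <;> grind

theorem add_apply_eq_iff_right (hu : u ∈ wordsOn I 1 a) (hv : v ∈ wordsOn (J \ I) (a + 1) k)
    {l : ℕ} (hl : a + 1 ≤ l) (i : Fin n) : (u + v) i = l ↔ v i = l := by
  have h := eq_zero_or_eq_zero hu hv i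
  rw [mem_wordsOn] at hu
  have h₁ := hu.1 i
  have h₂ := hu.2.1 i
  rw [Pi.add_apply]
  by_cases hi : i ∈ I <;> grind

end Decomposition

/-! ### The weights -/

/-- `∑ᵢ (wᵢ - 1)` as a natural number; by truncated subtraction blanks do not contribute. -/
def natMIL {n : ℕ} (w : Fin n → ℕ) : ℕ := ∑ i, (w i - 1)

theorem natMIL_add {n : ℕ} {u v : Fin n → ℕ} (h : ∀ i, u i = 0 ∨ v i = 0) :
    natMIL (u + v) = natMIL u + natMIL v := by
  rw [natMIL, natMIL, natMIL, ← Finset.sum_add_distrib]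
  refine Finset.sum_congr rfl fun i _ => ?_
  have := h i
  rw [Pi.add_apply]
  omega

/-- `∑ i χ(i ≻ i + 1)` over `1 ≤ i < s`, as a natural number. -/
def natMAJ {n : ℕ} (w : Fin n → ℕ) (s : ℕ) : ℕ :=
  ∑ i ∈ Finset.Ico 1 s, if Succ w i (i + 1) then i else 0

theorem natMAJ_succ {n : ℕ} (w : Fin n → ℕ) {s : ℕ} (hs : 1 ≤ s) :
    natMAJ w (s + 1) = natMAJ w s + if Succ w s (s + 1) then s else 0 :=
  Finset.sum_Ico_succ_top hs _

theorem natMAJ_congr {n : ℕ} {u w : Fin n → ℕ} {s : ℕ}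
    (h : ∀ l, 1 ≤ l → l ≤ s → ∀ i, u i = l ↔ w i = l) : natMAJ u s = natMAJ w s := by
  refine Finset.sum_congr rfl fun i hi => ?_
  rw [Finset.mem_Ico] at hi
  simp only [succ_congr (h i hi.1 hi.2.le) (h (i + 1) (by omega) hi.2)]

/-- `a ≻ a + 1 ≻ ⋯ ≻ b` in `w`. -/
def IsRun {n : ℕ} (w : Fin n → ℕ) (a b : ℕ) : Prop := ∀ l ∈ Finset.Ico a b, Succ w l (l + 1)

instance {n : ℕ} (w : Fin n → ℕ) (a b : ℕ) : Decidable (IsRun w a b) := by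
  unfold IsRun; infer_instance

theorem isRun_iff {n : ℕ} {w : Fin n → ℕ} {a b : ℕ} (h : a < b) :
    IsRun w a b ↔ Succ w a (a + 1) ∧ IsRun w (a + 1) b := by
  simp only [IsRun, Finset.mem_Ico, and_imp]
  constructor
  · exact fun H => ⟨H a le_rfl h, fun l hl => H l (by omega)⟩
  · rintro ⟨h₁, h₂⟩ l hl hl'
    rcases hl.eq_or_lt with rfl | hl
    · exact h₁
    · exact h₂ l hl hl'

theorem isRun_congr {n : ℕ} {u w : Fin n → ℕ} {a b : ℕ}
    (h : ∀ l, a ≤ l → ∀ i, u i = l ↔ w i = l) : IsRun u a b ↔ IsRun w a b := by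
  refine forall₂_congr fun l hl => ?_
  rw [Finset.mem_Ico] at hl
  exact succ_congr (h l hl.1) (h (l + 1) (by omega))

/-! ### Runs -/

/-- The words of `wordsOn J a b` in which `a ≻ a + 1 ≻ ⋯ ≻ b`: all the letters `b` come first, then
all the letters `b - 1`, and so on. -/
def runWords {n : ℕ} (J : Finset (Fin n)) (a b : ℕ) : Finset (Fin n → ℕ) :=
  (wordsOn J a b).filter fun w => IsRun w a b

theorem mem_runWords {n : ℕ} {J : Finset (Fin n)} {a b : ℕ} {w : Fin n → ℕ} :
    w ∈ runWords J a b ↔ ((∀ i ∈ J, a ≤ w i ∧ w i ≤ b) ∧ (∀ i ∉ J, w i = 0) ∧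
      ∀ l, a ≤ l → l ≤ b → ∃ i, w i = l) ∧
      ∀ l, a ≤ l → l < b → ∀ i j, w i = l → w j = l + 1 → j < i := by
  rw [runWords, Finset.mem_filter, mem_wordsOn]
  refine and_congr_right fun ⟨_, _, h⟩ => ?_
  simp only [IsRun, Finset.mem_Ico, succ_iff, and_imp]
  exact ⟨fun H l hl hl' => (H l hl hl').2.2,
    fun H l hl hl' => ⟨h l hl hl'.le, h (l + 1) (by omega) hl', H l hl hl'⟩⟩

/-- The last letter of a run on a nonempty set of positions is the least letter; removing it leaves
a run with the same letters, or with all but the least one. -/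
theorem runWords_insert {n : ℕ} {J : Finset (Fin n)} {x : Fin n} (hx : ∀ y ∈ J, y < x)
    {a b : ℕ} (ha : 1 ≤ a) (hab : a ≤ b) :
    runWords (insert x J) a b =
      (runWords J a b ∪ runWords J (a + 1) b).image fun w => Function.update w x a := by
  have hxJ : x ∉ J := fun h => (hx x h).false
  ext w
  simp only [Finset.mem_image, Finset.mem_union]
  constructor
  · intro hw
    rw [mem_runWords] at hw
    obtain ⟨⟨h₁, h₂, h₃⟩, h₄⟩ := hw
    have hwx : w x = a := by
      by_contra hne
      have := h₁ x (Finset.mem_insert_self x J)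
      obtain ⟨i, hi⟩ := h₃ (w x - 1) (by omega) (by omega)
      have hlt := h₄ (w x - 1) (by omega) (by omega) i x hi (by omega)
      have hiJ : i ∉ insert x J := fun h => by
        rcases Finset.mem_insert.1 h with rfl | h
        · exact hlt.false
        · exact (hlt.trans (hx i h)).false
      have := h₂ i hiJ
      omega
    refine ⟨Function.update w x 0, ?_, by simp [← hwx]⟩
    have hne : ∀ i ∈ J, i ≠ x := fun i hi => (hx i hi).ne
    by_cases hex : ∃ i, i ≠ x ∧ w i = a
    · left
      rw [mem_runWords]
      refine ⟨⟨?_, ?_, ?_⟩, ?_⟩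
      · intro i hi
        simpa [hne i hi] using h₁ i (Finset.mem_insert_of_mem hi)
      · intro i hi
        by_cases hix : i = x
        · simp [hix]
        · simpa [hix] using h₂ i (by simp [hix, hi])
      · intro l hl hl'
        rcases hl.eq_or_lt with rfl | hl
        · obtain ⟨i, hi, hi'⟩ := hex
          exact ⟨i, by simpa [hi] using hi'⟩
        · obtain ⟨i, hi⟩ := h₃ l hl.le hl'
          have hix : i ≠ x := by rintro rfl; omega
          exact ⟨i, by simpa [hix] using hi⟩
      · intro l hl hl' i j hi hj
        have hix : i ≠ x := by rintro rfl; simp at hi; omega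
        have hjx : j ≠ x := by rintro rfl; simp at hj
        rw [Function.update_of_ne hix] at hi
        rw [Function.update_of_ne hjx] at hj
        exact h₄ l hl hl' i j hi hj
    · right
      push Not at hex
      rw [mem_runWords]
      refine ⟨⟨?_, ?_, ?_⟩, ?_⟩
      · intro i hi
        have h5 := h₁ i (Finset.mem_insert_of_mem hi)
        have h6 := hex i (hne i hi)
        rw [Function.update_of_ne (hne i hi)]
        omega
      · intro i hi
        by_cases hix : i = x
        · simp [hix]
        · simpa [hix] using h₂ i (by simp [hix, hi])
      · intro l hl hl'
        obtain ⟨i, hi⟩ := h₃ l (by omega) hl'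
        have hix : i ≠ x := by rintro rfl; omega
        exact ⟨i, by simpa [hix] using hi⟩
      · intro l hl hl' i j hi hj
        have hix : i ≠ x := by rintro rfl; simp at hi; omega
        have hjx : j ≠ x := by rintro rfl; simp at hj
        rw [Function.update_of_ne hix] at hi
        rw [Function.update_of_ne hjx] at hj
        exact h₄ l (by omega) hl' i j hi hj
  · rintro ⟨w, hw, rfl⟩
    have hw' : (∀ i ∈ J, a ≤ w i ∧ w i ≤ b) ∧ (∀ i ∉ J, w i = 0) ∧
        (∀ l, a + 1 ≤ l → l ≤ b → ∃ i, w i = l) ∧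
        ∀ l, a ≤ l → l < b → ∀ i j, w i = l → w j = l + 1 → j < i := by
      rcases hw with hw | hw <;> rw [mem_runWords] at hw <;> obtain ⟨⟨h₁, h₂, h₃⟩, h₄⟩ := hw
      · exact ⟨h₁, h₂, fun l hl => h₃ l (by omega), h₄⟩
      · refine ⟨fun i hi => ⟨by have := h₁ i hi; omega, (h₁ i hi).2⟩, h₂, h₃, ?_⟩
        intro l hl hl' i j hi hj
        have hiJ : i ∈ J := by
          by_contra h
          have := h₂ i h
          omega
        have := h₁ i hiJ
        exact h₄ l (by omega) hl' i j hi hj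
    obtain ⟨h₁, h₂, h₃, h₄⟩ := hw'
    have hwx := h₂ x hxJ
    rw [mem_runWords]
    refine ⟨⟨?_, ?_, ?_⟩, ?_⟩
    · intro i hi
      rcases Finset.mem_insert.1 hi with rfl | hi
      · simp [hab]
      · simpa [(hx i hi).ne] using h₁ i hi
    · intro i hi
      rw [Finset.mem_insert, not_or] at hi
      simpa [hi.1] using h₂ i hi.2
    · intro l hl hl'
      rcases hl.eq_or_lt with rfl | hl
      · exact ⟨x, by simp⟩
      · obtain ⟨i, hi⟩ := h₃ l hl hl'
        have hix : i ≠ x := by rintro rfl; omega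
        exact ⟨i, by simpa [hix] using hi⟩
    · intro l hl hl' i j hi hj
      have hjx : j ≠ x := by rintro rfl; simp at hj; omega
      rw [Function.update_of_ne hjx] at hj
      by_cases hix : i = x
      · subst hix
        refine hx j ?_
        by_contra h
        have := h₂ j h
        omega
      · rw [Function.update_of_ne hix] at hi
        exact h₄ l hl hl' i j hi hj

theorem runWords_empty {n : ℕ} (a b : ℕ) (ha : 1 ≤ a) :
    runWords (∅ : Finset (Fin n)) a b = if b < a then {0} else ∅ := by
  ext w
  rw [mem_runWords]
  split_ifs with h
  · simp only [Finset.notMem_empty, Finset.mem_singleton]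
    constructor
    · exact fun hw => funext fun i => hw.1.2.1 i (by simp)
    · rintro rfl
      exact ⟨⟨by simp, by simp, by omega⟩, by omega⟩
  · simp only [Finset.notMem_empty, iff_false]
    rintro ⟨⟨-, h₂, h₃⟩, -⟩
    obtain ⟨i, hi⟩ := h₃ a le_rfl (by omega)
    have := h₂ i (by simp)
    omega

theorem natMIL_update {n : ℕ} {w : Fin n → ℕ} {x : Fin n} (hx : w x = 0) (a : ℕ) :
    natMIL (Function.update w x a) = (a - 1) + natMIL w := by
  rw [natMIL, natMIL, ← Finset.add_sum_erase _ _ (Finset.mem_univ x),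
    ← Finset.add_sum_erase (a := x) _ (fun i => w i - 1) (Finset.mem_univ x)]
  simp only [Function.update_self, hx, zero_tsub, zero_add]
  congr 1
  refine Finset.sum_congr rfl fun i hi => ?_
  rw [Function.update_of_ne (Finset.ne_of_mem_erase hi)]

theorem sum_runWords {n : ℕ} (J : Finset (Fin n)) (a b : ℕ) :
    ∑ w ∈ runWords J (a + 1) b, (X : ℤ[X]) ^ natMIL w = runSum a b J.card := by
  induction J using Finset.induction_on_max generalizing a with
  | empty =>
    rw [runWords_empty _ _ (by omega)]
    by_cases h : b ≤ a
    · simp [runSum, h, Nat.lt_succ_of_le h, natMIL]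
    · simp [runSum, h, show ¬ b < a + 1 by omega]
  | insert x J hx ih =>
    have hxJ : x ∉ J := fun h => (hx x h).false
    rw [Finset.card_insert_of_notMem hxJ]
    by_cases h : b ≤ a
    · have hempty : runWords (insert x J) (a + 1) b = ∅ := by
        refine Finset.eq_empty_of_forall_notMem fun w hw => ?_
        have := (mem_runWords.1 hw).1.1 x (Finset.mem_insert_self x J)
        omega
      simp [hempty, runSum, h]
    · have hzero : ∀ w ∈ runWords J (a + 1) b ∪ runWords J (a + 1 + 1) b, w x = 0 := by
        intro w hw
        rcases Finset.mem_union.1 hw with hw | hw <;> exact (mem_runWords.1 hw).1.2.1 x hxJ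
      have hdisj : Disjoint (runWords J (a + 1) b) (runWords J (a + 1 + 1) b) := by
        refine Finset.disjoint_left.2 fun w hw hw' => ?_
        rw [mem_runWords] at hw hw'
        obtain ⟨i, hi⟩ := hw.1.2.2 (a + 1) le_rfl (by omega)
        by_cases hiJ : i ∈ J
        · have := hw'.1.1 i hiJ
          omega
        · have := hw.1.2.1 i hiJ
          omega
      rw [runWords_insert hx (by omega) (by omega), Finset.sum_image, runSum_succ (by omega), ← ih,
        ← ih, ← Finset.sum_union hdisj, Finset.mul_sum]
      · refine Finset.sum_congr rfl fun w hw => ?_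
        rw [natMIL_update (hzero w hw), pow_add, Nat.add_sub_cancel]
      · intro w hw w' hw' heq
        funext i
        by_cases hi : i = x
        · rw [hi, hzero w hw, hzero w' hw']
        · simpa [hi] using congrFun heq i

/-! ### The distribution of `bmajMIL` -/

/-- Expanding the factors `q ^ (i χ(i ≻ i + 1))` from the largest `i` downwards. -/
theorem sum_isRun_eq {n k : ℕ} (J : Finset (Fin n))
    (ih : ∀ b < k, ∀ I : Finset (Fin n),
      ∑ w ∈ wordsOn I 1 b, (X : ℤ[X]) ^ (natMIL w + natMAJ w b) = eulerMahonian I.card b)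
    {a : ℕ} (ha : a < k) :
    (∑ w ∈ wordsOn J 1 k,
      if IsRun w (a + 1) k then (X : ℤ[X]) ^ (natMIL w + natMAJ w (a + 1)) else 0) =
    ∑ b ∈ Finset.range (a + 1), runCoeff b (a + 1) *
      binomConv (fun m => eulerMahonian m b) (runSum b k) J.card := by
  -- Without the pair `(a, a + 1)`, the letters up to `a` and the run above are independent.
  have hsplit : ∀ a < k, (∑ w ∈ wordsOn J 1 k,
      if IsRun w (a + 1) k then (X : ℤ[X]) ^ (natMIL w + natMAJ w a) else 0) =
      binomConv (fun m => eulerMahonian m a) (runSum a k) J.card := by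
    intro a ha
    rw [sum_wordsOn_eq_sum_powerset J ha.le, ← sum_powerset_eq_binomConv]
    refine Finset.sum_congr rfl fun I _ => ?_
    rw [← ih a ha I, ← sum_runWords, Finset.sum_mul_sum]
    refine Finset.sum_congr rfl fun u hu => ?_
    rw [runWords, Finset.sum_filter]
    refine Finset.sum_congr rfl fun v hv => ?_
    have h₁ : IsRun (u + v) (a + 1) k ↔ IsRun v (a + 1) k :=
      isRun_congr fun l hl => add_apply_eq_iff_right hu hv hl
    have h₂ : natMAJ (u + v) a = natMAJ u a :=
      natMAJ_congr fun l hl hl' => add_apply_eq_iff_left hu hv hl hl'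
    simp only [h₁, h₂, natMIL_add (eq_zero_or_eq_zero hu hv)]
    split_ifs <;> ring
  induction a with
  | zero =>
    rw [zero_add, Finset.sum_range_one, runCoeff_self_succ, one_mul, ← hsplit 0 ha]
    simp [natMAJ]
  | succ a iha =>
    rw [Finset.sum_range_succ, runCoeff_self_succ, one_mul, ← hsplit (a + 1) ha]
    have hc : ∀ b ∈ Finset.range (a + 1), runCoeff b (a + 1 + 1) *
        binomConv (fun m => eulerMahonian m b) (runSum b k) J.card =
        (X ^ (a + 1) - 1) * (runCoeff b (a + 1) *
          binomConv (fun m => eulerMahonian m b) (runSum b k) J.card) := by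
      intro b hb
      rw [runCoeff_succ_right (Finset.mem_range.1 hb)]
      ring
    rw [Finset.sum_congr rfl hc, ← Finset.mul_sum, ← iha (by omega), Finset.mul_sum,
      ← Finset.sum_add_distrib]
    refine Finset.sum_congr rfl fun w _ => ?_
    rw [natMAJ_succ w (by omega)]
    simp only [isRun_iff (w := w) ha]
    by_cases h₁ : IsRun w (a + 1 + 1) k <;> by_cases h₂ : Succ w (a + 1) (a + 1 + 1) <;>
      simp only [h₁, h₂, and_self, and_true, and_false, if_true, if_false] <;> ring

theorem sum_wordsOn {n : ℕ} (J : Finset (Fin n)) (k : ℕ) :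
    ∑ w ∈ wordsOn J 1 k, (X : ℤ[X]) ^ (natMIL w + natMAJ w k) = eulerMahonian J.card k := by
  induction k using Nat.strong_induction_on generalizing J with
  | _ k ih =>
    obtain _ | k := k
    · rcases J.eq_empty_or_nonempty with rfl | ⟨x, hx⟩
      · have : wordsOn (∅ : Finset (Fin n)) 1 0 = {0} := by
          ext w
          rw [mem_wordsOn, Finset.mem_singleton, funext_iff]
          simp +contextual
          omega
        simp [this, natMIL, natMAJ]
      · have : wordsOn J 1 0 = ∅ := by
          refine Finset.eq_empty_of_forall_notMem fun w hw => ?_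
          have := (mem_wordsOn.1 hw).1 x hx
          omega
        obtain ⟨m, hm⟩ := Nat.exists_eq_succ_of_ne_zero (Finset.card_ne_zero_of_mem hx)
        simp [this, hm]
    · rw [← sum_runCoeff_mul_binomConv, ← sum_isRun_eq J (fun b hb I => ih b hb I) k.lt_succ_self]
      refine Finset.sum_congr rfl fun w _ => ?_
      rw [if_pos]
      simp [IsRun]

theorem bMAJ_eq_natMAJ {n : ℕ} (w : Fin n → ℕ) : bMAJ w = natMAJ w (bk w) := by
  simp [bMAJ, natMAJ]

theorem bmajMIL_eq {n k : ℕ} {w : Fin n → ℕ} (hw : w ∈ URG n k) :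
    bmajMIL w = (natMIL w + natMAJ w k : ℕ) := by
  obtain ⟨hURG, rfl⟩ := mem_URG.1 hw
  have hMIL : MIL w = natMIL w := by
    rw [MIL, natMIL, Nat.cast_sum]
    exact Finset.sum_congr rfl fun i _ => by rw [Nat.cast_sub (hURG.1 i), Nat.cast_one]
  rw [bmajMIL, bMAJ_eq_natMAJ, hMIL, Nat.cast_add, add_comm]

theorem sum_bmajMIL {n k : ℕ} (hk : 1 ≤ k) :
    ∑ w ∈ URG n k, (LaurentPolynomial.T (bmajMIL w) : LaurentPolynomial ℤ) =
      toLaurent (eulerMahonian n k) := by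
  have h := sum_wordsOn (Finset.univ : Finset (Fin n)) k
  rw [wordsOn_univ hk, Finset.card_univ, Fintype.card_fin] at h
  rw [← h, map_sum]
  refine Finset.sum_congr rfl fun w hw => ?_
  rw [bmajMIL_eq hw, toLaurent_X_pow]

/-! ### The distribution of `bmajBAST` -/

theorem sum_wordsOn_shift {n : ℕ} {M : Type*} [AddCommMonoid M] (J : Finset (Fin n)) {a k : ℕ}
    (ha : 1 ≤ a) (φ : (Fin n → ℕ) → M) :
    ∑ v ∈ wordsOn J (a + 1) (k + 1), φ (fun i => v i - 1) = ∑ v ∈ wordsOn J a k, φ v := by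
  refine Finset.sum_bij' (fun v _ i => v i - 1) (fun v _ i => if i ∈ J then v i + 1 else 0)
    ?_ ?_ ?_ ?_ fun _ _ => rfl
  · intro v hv
    rw [mem_wordsOn] at hv ⊢
    obtain ⟨h₁, h₂, h₃⟩ := hv
    refine ⟨fun i hi => ?_, fun i hi => by simp [h₂ i hi], fun l hl hl' => ?_⟩
    · have := h₁ i hi
      omega
    · obtain ⟨i, hi⟩ := h₃ (l + 1) (by omega) (by omega)
      exact ⟨i, by simp [hi]⟩
  · intro v hv
    rw [mem_wordsOn] at hv ⊢
    obtain ⟨h₁, h₂, h₃⟩ := hv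
    refine ⟨fun i hi => ?_, fun i hi => if_neg hi, fun l hl hl' => ?_⟩
    · simpa [hi] using h₁ i hi
    · obtain ⟨i, hi⟩ := h₃ (l - 1) (by omega) (by omega)
      have hiJ : i ∈ J := by
        by_contra h
        have := h₂ i h
        omega
      exact ⟨i, by rw [if_pos hiJ]; omega⟩
  · intro v hv
    rw [mem_wordsOn] at hv
    funext i
    by_cases hi : i ∈ J
    · have := hv.1 i hi
      simp only [hi, if_true]
      omega
    · simp [hi, hv.2.1 i hi]
  · intro v hv
    rw [mem_wordsOn] at hv
    funext i
    by_cases hi : i ∈ J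
    · simp [hi]
    · simp [hi, hv.2.1 i hi]

theorem card_le_sup_succ (I : Finset ℕ) : I.card ≤ I.sup (· + 1) := by
  have h : I ⊆ Finset.range (I.sup (· + 1)) := fun i hi =>
    Finset.mem_range.2 (Finset.le_sup (f := (· + 1)) hi)
  simpa using Finset.card_le_card h

/-- The value of `bmajBAST` in terms of the set `I` of positions of the letter `1` and the word `v`
that remains when these letters are removed and the others are lowered by one. The weight of the
pair `(1, 2)` in `bMAJ + bndes` does not depend on whether `1 ≻ 2`. -/
theorem bmajBAST_add {n k : ℕ} {I : Finset (Fin n)} {u v : Fin n → ℕ}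
    (hu : u ∈ wordsOn I 1 1) (hv : v ∈ wordsOn (Finset.univ \ I) 2 (k + 1))
    (hw : u + v ∈ URG n (k + 1)) :
    bmajBAST (u + v) = (k + ((I.map Fin.valEmbedding).sup (· + 1) - I.card) +
      (natMIL (fun i => v i - 1) + natMAJ (fun i => v i - 1) k) : ℕ) := by
  have hbk := (mem_URG.1 hw).2
  have hu' := mem_wordsOn.1 hu
  have hv' := mem_wordsOn.1 hv
  have hpro : pro (u + v) = (I.map Fin.valEmbedding).sup (· + 1) := by
    rw [pro, Finset.sup_map]
    refine Finset.sup_congr ?_ fun _ _ => rfl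
    ext i
    rw [Finset.mem_filter, add_apply_eq_iff_left hu hv le_rfl le_rfl]
    by_cases hi : i ∈ I
    · have := hu'.1 i hi
      simp only [Finset.mem_univ, true_and, hi, iff_true]
      omega
    · simp [hi, hu'.2.1 i hi]
  have hcard : I.card ≤ (I.map Fin.valEmbedding).sup (· + 1) := by
    simpa using card_le_sup_succ (I.map Fin.valEmbedding)
  have hMIL : MIL (u + v) = natMIL (fun i => v i - 1) + ((n : ℤ) - I.card) := by
    have hn : (n : ℤ) - I.card = ∑ i : Fin n, if i ∈ I then (0 : ℤ) else 1 := by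
      rw [Finset.sum_ite]
      simp only [Finset.sum_const_zero, zero_add, Finset.sum_const, nsmul_eq_mul, mul_one]
      have h := Finset.card_compl_add_card I
      rw [Fintype.card_fin] at h
      have h' : (Finset.univ.filter fun i => i ∉ I) = Iᶜ := by ext; simp
      rw [h']
      omega
    rw [hn, MIL, natMIL, Nat.cast_sum, ← Finset.sum_add_distrib]
    refine Finset.sum_congr rfl fun i _ => ?_
    rw [Pi.add_apply]
    split_ifs with hi
    · have h₁ := hu'.1 i hi
      have h₂ := hv'.2.1 i (by simp [hi])
      omega
    · have h₁ := hu'.2.1 i hi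
      have h₂ := hv'.1 i (by simp [hi])
      omega
  have hMAJ : bMAJ (u + v) -
      ∑ i ∈ Finset.Ico 1 (k + 1), (if Succ (u + v) i (i + 1) then (1 : ℤ) else 0) =
      natMAJ (fun i => v i - 1) k := by
    rw [bMAJ, hbk, ← Finset.sum_sub_distrib, Finset.sum_Ico_eq_sum_range, Nat.add_sub_cancel,
      natMAJ, Nat.cast_sum]
    obtain _ | k := k
    · simp
    rw [Finset.sum_range_succ', Finset.sum_Ico_eq_sum_range, Nat.add_sub_cancel]
    -- The pair `(1, 2)` contributes `1 - 1` or `0`, so that nothing depends on the letter `1`.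
    have h₀ : ((1 + 0 : ℕ) : ℤ) * (if Succ (u + v) (1 + 0) (1 + 0 + 1) then 1 else 0) -
        (if Succ (u + v) (1 + 0) (1 + 0 + 1) then 1 else 0) = 0 := by simp
    rw [h₀, add_zero]
    refine Finset.sum_congr rfl fun i _ => ?_
    have hS : Succ (u + v) (1 + (i + 1)) (1 + (i + 1) + 1) ↔
        Succ (fun i => v i - 1) (1 + i) (1 + i + 1) := by
      refine succ_congr (fun j => ?_) fun j => ?_ <;>
      · rw [add_apply_eq_iff_right hu hv (by omega)]
        omega
    simp only [hS]
    split_ifs <;> push_cast <;> ring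
  rw [bmajBAST, bndes, bmajMIL, hpro, hMIL, hbk]
  push_cast [Nat.cast_sub hcard]
  linear_combination hMAJ

theorem card_wordsOn_one {n : ℕ} (I : Finset (Fin n)) :
    (wordsOn I 1 1).card = if I.Nonempty then 1 else 0 := by
  split_ifs with h
  · rw [Finset.card_eq_one]
    refine ⟨fun i => if i ∈ I then 1 else 0, ?_⟩
    ext w
    rw [mem_wordsOn, Finset.mem_singleton]
    constructor
    · rintro ⟨h₁, h₂, -⟩
      funext i
      split_ifs with hi
      · exact le_antisymm (h₁ i hi).2 (h₁ i hi).1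
      · exact h₂ i hi
    · rintro rfl
      obtain ⟨x, hx⟩ := h
      exact ⟨fun i hi => by simp [hi], fun i hi => by simp [hi],
        fun l hl hl' => ⟨x, by simp only [hx, if_true]; omega⟩⟩
  · rw [Finset.card_eq_zero]
    refine Finset.eq_empty_of_forall_notMem fun w hw => ?_
    rw [mem_wordsOn] at hw
    obtain ⟨i, hi⟩ := hw.2.2 1 le_rfl le_rfl
    have := hw.2.1 i fun hiI => h ⟨i, hiI⟩
    omega

theorem sum_powerset_univ_fin {n : ℕ} {M : Type*} [AddCommMonoid M] (f : Finset ℕ → M) :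
    ∑ I ∈ (Finset.univ : Finset (Fin n)).powerset, f (I.map Fin.valEmbedding) =
      ∑ I ∈ (Finset.range n).powerset, f I := by
  have h : Finset.range n = Finset.univ.map (Fin.valEmbedding (n := n)) := by
    ext i
    simp
  refine Finset.sum_nbij (fun I => I.map Fin.valEmbedding) ?_ ?_ ?_ fun _ _ => rfl
  · intro I _
    rw [Finset.mem_powerset, h]
    exact Finset.map_subset_map.2 (Finset.subset_univ I)
  · exact fun I _ I' _ hI => Finset.map_injective _ hI
  · intro I hI
    rw [Finset.mem_coe, Finset.mem_powerset, h, Finset.subset_map_iff] at hI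
    obtain ⟨I', hI', rfl⟩ := hI
    exact ⟨I', by simp, rfl⟩

theorem sum_bmajBAST {n k : ℕ} :
    ∑ w ∈ URG n (k + 1), (LaurentPolynomial.T (bmajBAST w) : LaurentPolynomial ℤ) =
      toLaurent (eulerMahonian n (k + 1)) := by
  have hsum : ∀ I ∈ (Finset.univ : Finset (Fin n)).powerset,
      (∑ u ∈ wordsOn I 1 1, ∑ v ∈ wordsOn (Finset.univ \ I) (1 + 1) (k + 1),
        (LaurentPolynomial.T (bmajBAST (u + v)) : LaurentPolynomial ℤ)) =
      toLaurent (X ^ k * if (I.map Fin.valEmbedding).Nonempty then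
        X ^ ((I.map Fin.valEmbedding).sup (· + 1) - (I.map Fin.valEmbedding).card) *
          eulerMahonian (n - (I.map Fin.valEmbedding).card) k else 0) := by
    intro I hI
    have hcard : (Finset.univ \ I).card = n - I.card := by
      rw [Finset.card_sdiff_of_subset (Finset.subset_univ I), Finset.card_univ, Fintype.card_fin]
    have hv : ∀ u ∈ wordsOn I 1 1, (∑ v ∈ wordsOn (Finset.univ \ I) (1 + 1) (k + 1),
        (LaurentPolynomial.T (bmajBAST (u + v)) : LaurentPolynomial ℤ)) =
        toLaurent (X ^ k * (X ^ ((I.map Fin.valEmbedding).sup (· + 1) - I.card) *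
          eulerMahonian (n - I.card) k)) := by
      intro u hu
      rw [← hcard, ← sum_wordsOn, ← sum_wordsOn_shift _ le_rfl, ← mul_assoc, ← pow_add,
        Finset.mul_sum, map_sum]
      refine Finset.sum_congr rfl fun v hv => ?_
      rw [bmajBAST_add hu hv, ← pow_add, toLaurent_X_pow]
      rw [← wordsOn_univ (by omega), mem_wordsOn]
      have hu' := mem_wordsOn.1 hu
      have hv' := mem_wordsOn.1 hv
      refine ⟨fun i _ => ?_, by simp, fun l hl hl' => ?_⟩
      · rw [Pi.add_apply]
        by_cases hi : i ∈ I
        · have h₁ := hu'.1 i hi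
          have h₂ := hv'.2.1 i (by simp [hi])
          omega
        · have h₁ := hu'.2.1 i hi
          have h₂ := hv'.1 i (by simp [hi])
          omega
      · rcases hl.eq_or_lt with rfl | hl
        · obtain ⟨i, hi⟩ := hu'.2.2 1 le_rfl le_rfl
          exact ⟨i, (add_apply_eq_iff_left hu hv le_rfl le_rfl i).2 hi⟩
        · obtain ⟨i, hi⟩ := hv'.2.2 l hl hl'
          exact ⟨i, (add_apply_eq_iff_right hu hv hl i).2 hi⟩
    rw [Finset.sum_congr rfl hv, Finset.sum_const, card_wordsOn_one, Finset.card_map]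
    by_cases hne : I.Nonempty <;> simp [hne]
  rw [← wordsOn_univ (by omega), sum_wordsOn_eq_sum_powerset _ (Nat.le_add_left 1 k),
    Finset.sum_congr rfl hsum, ← lastTransform_eulerMahonian, lastTransform, Finset.mul_sum,
    map_sum]
  exact sum_powerset_univ_fin fun I => toLaurent (X ^ k * if I.Nonempty then
    X ^ (I.sup (· + 1) - I.card) * eulerMahonian (n - I.card) k else 0)

end GrowthFunction

/-- Both sums and the right-hand side are compared in the ring `ℤ[q, q⁻¹]` of Laurent polynomials,
in which `LaurentPolynomial.T m` is `q ^ m` for an integer `m`. -/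
theorem mainTheorem2 (n k : ℕ) (hk : 1 ≤ k) (hkn : k ≤ n) :
    (∑ w ∈ GrowthFunction.URG n k,
        (LaurentPolynomial.T (GrowthFunction.bmajMIL w) : LaurentPolynomial ℤ)) =
      ∑ w ∈ GrowthFunction.URG n k,
        (LaurentPolynomial.T (GrowthFunction.bmajBAST w) : LaurentPolynomial ℤ) ∧
    (∑ w ∈ GrowthFunction.URG n k,
        (LaurentPolynomial.T (GrowthFunction.bmajBAST w) : LaurentPolynomial ℤ)) =
      Polynomial.toLaurent (GrowthFunction.qFact k * GrowthFunction.qStirling n k) := by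
  obtain ⟨k, rfl⟩ := Nat.exists_eq_add_of_le' hk
  rw [GrowthFunction.sum_bmajMIL hk, GrowthFunction.sum_bmajBAST]
  exact ⟨rfl, rfl⟩
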